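/- For $r\in\mathbb N$ let $\langle r\rangle=\sum_{i=1}^r e_i\otimes e_i\otimes e_i\in\mathbb C^r\otimes\mathbb C^r\otimes\mathbb C^r$ be the unit tensor; for $n\in\mathbb N$ let $$\mathsf M_n=\sum_{i,j,k=1}^n e_{i,j}\otimes e_{j,k}\otimes e_{k,i}\in\mathbb C^{n^2}\otimes\mathbb C^{n^2}\otimes\mathbb C^{n^2}$$ be the $n\times n$ matrix multiplication tensor; and for integers $a,b\ge 1$ let $$\mathsf P_{a,b}=\sum_{i=1}^a\sum_{j=1}^b e_i\otimes e_j\otimes e_{i+j-1}\in\mathbb C^a\otimes\mathbb C^b\otimes\mathbb C^{a+b-1}$$ be the polynomial multiplication tensor. For $T\in\mathbb C^{a_1}\otimes\mathbb C^{a_2}\otimes\mathbb C^{a_3}$ and $S\in\mathbb C^{b_1}\otimes\mathbb C^{b_2}\otimes\mathbb C^{b_3}$, say that $T$ restricts to $S$ if $S=(A\otimes B\otimes C)T$ for some linear maps $A,B,C$, and that $T$ degenerates to $S$ if there is a sequence of tensors $T_1,T_2,\dots$ in $\mathbb C^{b_1}\otimes\mathbb C^{b_2}\otimes\mathbb C^{b_3}$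 that converges to $S$ and such that $T$ restricts to every $T_i$. The border subrank of $T$ is the largest $r\in\mathbb N$ such that $T$ degenerates to $\langle r\rangle$. Theorem 1.6. For every $n\in\mathbb N$, the border subrank of $\mathsf M_n$ is at most $\lceil\tfrac34 n^2\rceil$. Moreover, for all integers $a,b\ge1$ with $b>n\bigl(n-\lfloor\sqrt{a-1}\rfloor\bigr)$, the tensor $\mathsf M_n$ does not degenerate to $\mathsf P_{a,b}$. -/

import Mathlib

open Filter Topology

namespace BorderSubrank

/-- The space `ℂ^ι ⊗ ℂ^κ ⊗ ℂ^μ` of order-three tensors in coordinates, with its Euclidean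
(product) topology; the index sets are finite wherever tensors are used. -/
abbrev Tensor (ι κ μ : Type*) := ι → κ → μ → ℂ

/-- The elementary tensor `u ⊗ v ⊗ w`. -/
def pureTensor {ι κ μ : Type*} (u : ι → ℂ) (v : κ → ℂ) (w : μ → ℂ) : Tensor ι κ μ :=
  fun i j k => u i * v j * w k

/-- The action `(A ⊗ B ⊗ C) T` of a triple of (not necessarily square) matrices. -/
def act {ι κ μ ι' κ' μ' : Type*} [Fintype ι] [Fintype κ] [Fintype μ]
    (A : Matrix ι' ι ℂ) (B : Matrix κ' κ ℂ) (C : Matrix μ' μ ℂ)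
    (T : Tensor ι κ μ) : Tensor ι' κ' μ' :=
  fun i' j' k' => ∑ i, ∑ j, ∑ k, A i' i * B j' j * C k' k * T i j k

/-- `T ≥ S`: the tensor `T` restricts to `S`. -/
def RestrictsTo {ι κ μ ι' κ' μ' : Type*} [Fintype ι] [Fintype κ] [Fintype μ]
    (T : Tensor ι κ μ) (S : Tensor ι' κ' μ') : Prop :=
  ∃ (A : Matrix ι' ι ℂ) (B : Matrix κ' κ ℂ) (C : Matrix μ' μ ℂ), S = act A B C T

/-- `T ⊵ S`: the tensor `T` degenerates to `S`, that is, `S` is the limit of a sequence of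
restrictions of `T`. -/
def DegeneratesTo {ι κ μ ι' κ' μ' : Type*} [Fintype ι] [Fintype κ] [Fintype μ]
    (T : Tensor ι κ μ) (S : Tensor ι' κ' μ') : Prop :=
  ∃ s : ℕ → Tensor ι' κ' μ', (∀ m, RestrictsTo T (s m)) ∧ Tendsto s atTop (𝓝 S)

/-- The unit tensor `⟨r⟩ = ∑ᵢ eᵢ ⊗ eᵢ ⊗ eᵢ`. -/
def unitTensor (r : ℕ) : Tensor (Fin r) (Fin r) (Fin r) :=
  ∑ i : Fin r, pureTensor (Pi.single i 1) (Pi.single i 1) (Pi.single i 1)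

/-- The matrix multiplication tensor `M_n = ∑ e_{i,j} ⊗ e_{j,k} ⊗ e_{k,i}`, where the coordinates
of `ℂ^{n²}` are indexed by pairs. -/
def matMulTensor (n : ℕ) : Tensor (Fin n × Fin n) (Fin n × Fin n) (Fin n × Fin n) :=
  ∑ i : Fin n, ∑ j : Fin n, ∑ k : Fin n,
    pureTensor (Pi.single (i, j) 1) (Pi.single (j, k) 1) (Pi.single (k, i) 1)

/-- The polynomial multiplication tensor `P_{a,b} = ∑ e_i ⊗ e_j ⊗ e_{i+j-1}`; here indices start
at `0`, so that `e_{i+j-1}` becomes `e_{i+j}`. -/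
def polyMulTensor (a b : ℕ) : Tensor (Fin a) (Fin b) (Fin (a + b - 1)) :=
  ∑ i : Fin a, ∑ j : Fin b,
    pureTensor (Pi.single i 1) (Pi.single j 1)
      (Pi.single (⟨(i : ℕ) + (j : ℕ), by have := i.2; have := j.2; omega⟩ : Fin (a + b - 1)) 1)

/-- The border subrank: the largest `r` such that `T` degenerates to `⟨r⟩`. -/
noncomputable def borderSubrank {ι κ μ : Type*} [Fintype ι] [Fintype κ] [Fintype μ]
    (T : Tensor ι κ μ) : ℕ :=
  sSup {r : ℕ | DegeneratesTo T (unitTensor r)}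

theorem unitTensor_apply (r : ℕ) (i j k : Fin r) :
    unitTensor r i j k = if i = j ∧ j = k then 1 else 0 := by
  simp only [unitTensor, pureTensor, Finset.sum_apply, Pi.single_apply]
  by_cases h : i = j ∧ j = k
  · obtain ⟨rfl, rfl⟩ := h
    simp
  · rw [if_neg h]
    refine Finset.sum_eq_zero fun x _ => ?_
    by_cases h1 : i = x <;> by_cases h2 : j = x <;> by_cases h3 : k = x <;> simp_all

/-- A tensor with first dimension `|ι|` degenerates to `⟨r⟩` only if `r ≤ |ι|`. -/
theorem le_card_of_degeneratesTo {ι κ μ : Type*} [Fintype ι] [Fintype κ] [Fintype μ]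
    (T : Tensor ι κ μ) (r : ℕ) (h : DegeneratesTo T (unitTensor r)) : r ≤ Fintype.card ι := by
  classical
  by_contra hr
  push Not at hr
  obtain ⟨s, hs, hlim⟩ := h
  let f : Tensor (Fin r) (Fin r) (Fin r) → Matrix (Fin r) (Fin r) ℂ :=
    fun S => Matrix.of fun i j => ∑ k, S i j k
  have hf : Continuous fun S => (f S).det := by
    refine Continuous.matrix_det ?_
    refine continuous_matrix fun i j => ?_
    simp only [f, Matrix.of_apply]
    fun_prop
  have h0 : ∀ m, (f (s m)).det = 0 := by
    intro m
    obtain ⟨A, B, C, hm⟩ := hs m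
    have hfac : f (s m) = A * Matrix.of fun (i : ι) (j' : Fin r) =>
        ∑ k' : Fin r, ∑ j, ∑ k, B j' j * C k' k * T i j k := by
      ext i' j'
      rw [hm]
      simp only [f, act, Matrix.of_apply, Matrix.mul_apply, Finset.mul_sum]
      rw [Finset.sum_comm]
      simp only [mul_assoc]
    by_contra hdet
    have hu : IsUnit (f (s m)) := (Matrix.isUnit_iff_isUnit_det _).2 (Ne.isUnit hdet)
    have h1 := Matrix.rank_of_isUnit _ hu
    have h2 : (f (s m)).rank ≤ A.rank := by rw [hfac]; exact Matrix.rank_mul_le_left _ _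
    have h3 := A.rank_le_card_width
    simp only [Fintype.card_fin] at h1
    omega
  have h1 : f (unitTensor r) = 1 := by
    ext i j
    simp only [f, Matrix.of_apply, unitTensor_apply, Matrix.one_apply]
    by_cases hij : i = j <;> simp [hij]
  have h2 : Tendsto (fun m => (f (s m)).det) atTop (𝓝 (f (unitTensor r)).det) :=
    (hf.tendsto _).comp hlim
  simp only [h0, h1, Matrix.det_one] at h2
  exact zero_ne_one (tendsto_nhds_unique tendsto_const_nhds h2)

/-- The maximum in the definition of the border subrank is attained. -/
theorem isGreatest_borderSubrank {ι κ μ : Type*} [Fintype ι] [Fintype κ] [Fintype μ]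
    (T : Tensor ι κ μ) :
    IsGreatest {r : ℕ | DegeneratesTo T (unitTensor r)} (borderSubrank T) := by
  have hb : BddAbove {r : ℕ | DegeneratesTo T (unitTensor r)} :=
    ⟨Fintype.card ι, fun r hr => le_card_of_degeneratesTo T r hr⟩
  have hne : {r : ℕ | DegeneratesTo T (unitTensor r)}.Nonempty := by
    refine ⟨0, fun _ => unitTensor 0, fun _ => ⟨0, 0, 0, ?_⟩, tendsto_const_nhds⟩
    exact Subsingleton.elim _ _
  exact ⟨Nat.sSup_mem hne hb, fun r hr => le_csSup hb hr⟩

end BorderSubrank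

namespace BorderSubrank

/-! Contracting `matMulTensor n` along its first factor with a matrix of rank `k` gives that matrix
(transposed) tensored with an identity, of rank `k * n`. Matrices of rank at most `s` form a cone of
codimension `(n - s) ^ 2`, so every linear space of larger dimension meets it outside the origin
(`exists_rank_le_of_sq_lt`). Hence if `matMulTensor n` degenerates to `S`, every space of more than
`(n - s) ^ 2` dimensions of contraction vectors contains a nonzero one whose contraction of `S` has
rank at most `s * n`. Vanishing of minors is closed and unit spheres are compact, so this passes
from restrictions to limits (`exists_minors_eq_zero_of_degeneratesTo`). The unit tensor contracts to
diagonal matrices, and a suitable subspace has few zeros in each nonzero vector; `polyMulTensor a b`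
contracts to rank `b` at every nonzero vector. Optimizing `s` gives both bounds. -/

/-! ### Integrality over homogeneous polynomials without a common nontrivial zero -/

open MvPolynomial in
theorem homogeneousComponent_add_mul {σ K : Type*} [CommSemiring K] {f : MvPolynomial σ K} {d : ℕ}
    (hf : f.IsHomogeneous d) (g : MvPolynomial σ K) (e : ℕ) :
    homogeneousComponent (e + d) (g * f) = homogeneousComponent e g * f := by
  let := MvPolynomial.gradedAlgebra (σ := σ) (R := K)
  have h := DirectSum.coe_decompose_mul_add_of_right_mem (homogeneousSubmodule σ K) (i := e)
    (a := g) (b := f) ((mem_homogeneousSubmodule d f).2 hf)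
  have hc : ∀ (i : ℕ) (p : MvPolynomial σ K),
      (DirectSum.decompose (homogeneousSubmodule σ K) p i : MvPolynomial σ K) =
        homogeneousComponent i p := fun i p => decomposition.decompose'_apply p i
  rwa [hc, hc] at h

open MvPolynomial in
theorem homogeneousComponent_mul_of_lt {σ K : Type*} [CommSemiring K] {f : MvPolynomial σ K}
    {d : ℕ} (hf : f.IsHomogeneous d) (g : MvPolynomial σ K) {e : ℕ} (he : e < d) :
    homogeneousComponent e (g * f) = 0 := by
  let := MvPolynomial.gradedAlgebra (σ := σ) (R := K)
  have h := DirectSum.coe_decompose_mul_of_right_mem_of_not_le (homogeneousSubmodule σ K) (n := e)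
    (a := g) (b := f) ((mem_homogeneousSubmodule d f).2 hf) (not_le.2 he)
  have hc : ∀ (i : ℕ) (p : MvPolynomial σ K),
      (DirectSum.decompose (homogeneousSubmodule σ K) p i : MvPolynomial σ K) =
        homogeneousComponent i p := fun i p => decomposition.decompose'_apply p i
  rwa [hc] at h

open MvPolynomial in
/-- Homogeneous polynomials of positive degree with no common zero but the origin generate a
subalgebra over which the polynomial ring is integral. -/
theorem isIntegral_adjoin_of_homogeneous {σ ι K : Type*} [Finite σ] [Finite ι] [Field K]
    [IsAlgClosed K] (f : ι → MvPolynomial σ K) (d : ι → ℕ) (hd : ∀ i, 0 < d i)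
    (hf : ∀ i, (f i).IsHomogeneous (d i))
    (h0 : ∀ x : σ → K, (∀ i, eval x (f i) = 0) → x = 0) :
    Algebra.IsIntegral (Algebra.adjoin K (Set.range f)) (MvPolynomial σ K) := by
  classical
  cases nonempty_fintype ι
  set B := Algebra.adjoin K (Set.range f) with hB
  let m : Ideal (MvPolynomial σ K) := Ideal.span (Set.range X)
  let I : Ideal (MvPolynomial σ K) := Ideal.span (Set.range f)
  -- Nullstellensatz: the only common zero is the origin, so some power of `m` lies in `I`.
  have hrad : m ≤ I.radical := by
    rw [← vanishingIdeal_zeroLocus_eq_radical (K := K) I, Ideal.span_le]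
    rintro _ ⟨i, rfl⟩
    rw [SetLike.mem_coe, mem_vanishingIdeal_iff]
    intro x hx
    have : x = 0 := h0 x fun i => by
      have := hx (f i) (Ideal.subset_span ⟨i, rfl⟩)
      simpa [aeval_eq_eval] using this
    simp [this]
  obtain ⟨N, hN⟩ := Ideal.exists_pow_le_of_le_radical_of_fg hrad
    ⟨(Set.finite_range X).toFinset, by simp [m]⟩
  let T : Set (MvPolynomial σ K) := (fun s : σ →₀ ℕ => monomial s (1 : K)) '' {s | s.degree ≤ N}
  have hT : T.Finite := (Finsupp.finite_of_degree_le N).image _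
  let M : Submodule B (MvPolynomial σ K) := Submodule.span B T
  have hMmul : ∀ i, ∀ p ∈ M, p * f i ∈ M := fun i p hp => by
    have := M.smul_mem (⟨f i, Algebra.subset_adjoin ⟨i, rfl⟩⟩ : B) hp
    rwa [Subalgebra.smul_def, smul_eq_mul, mul_comm] at this
  have hMC : ∀ (a : K), ∀ p ∈ M, C a * p ∈ M := fun a p hp => by
    have := M.smul_mem (algebraMap K B a) hp
    rwa [Subalgebra.smul_def, smul_eq_mul] at this
  -- Monomials of degree at most `N` generate: a form of larger degree lies in `I`, so it is a
  -- combination of the `f i` whose coefficients can be taken homogeneous of smaller degree, since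
  -- `d i > 0`.
  have hom : ∀ e : ℕ, ∀ p : MvPolynomial σ K, p.IsHomogeneous e → p ∈ M := by
    intro e
    induction e using Nat.strong_induction_on with
    | _ e ih =>
      intro p hp
      by_cases he : e ≤ N
      · rw [p.as_sum]
        refine M.sum_mem fun s hs => ?_
        have hdeg : s.degree = e := by
          by_contra h
          exact (mem_support_iff.1 hs) (hp.coeff_eq_zero h)
        have h1 : monomial s (1 : K) ∈ M := Submodule.subset_span ⟨s, hdeg.le.trans he, rfl⟩
        have := hMC (coeff s p) _ h1
        rwa [C_mul_monomial, mul_one] at this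
      · have hpI : p ∈ I := by
          refine hN (Ideal.pow_le_pow_right (not_le.1 he).le ?_)
          rw [p.as_sum]
          refine Ideal.sum_mem _ fun s hs => ?_
          have hdeg : s.degree = e := by
            by_contra h
            exact (mem_support_iff.1 hs) (hp.coeff_eq_zero h)
          rw [Ideal.mem_span_pow_iff_exists_isHomogeneous]
          refine ⟨monomial s (C (coeff s p)), isHomogeneous_monomial _ hdeg, ?_⟩
          rw [eval_monomial, monomial_eq]
        obtain ⟨g, hg⟩ := Ideal.mem_span_range_iff_exists_fun.1 hpI
        have hpe : p = ∑ i, homogeneousComponent e (g i * f i) := by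
          rw [← map_sum, hg, homogeneousComponent_eq_self hp]
        rw [hpe]
        refine M.sum_mem fun i _ => ?_
        by_cases hde : d i ≤ e
        · obtain ⟨k, rfl⟩ := Nat.exists_eq_add_of_le' hde
          rw [homogeneousComponent_add_mul (hf i)]
          exact hMmul i _ (ih k (by have := hd i; omega) _ (homogeneousComponent_isHomogeneous _ _))
        · rw [homogeneousComponent_mul_of_lt (hf i) _ (not_le.1 hde)]
          exact M.zero_mem
  have hfin : Module.Finite B (MvPolynomial σ K) := by
    refine ⟨⟨hT.toFinset, ?_⟩⟩
    rw [hT.coe_toFinset, eq_top_iff]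
    intro p _
    rw [← sum_homogeneousComponent p]
    exact Submodule.sum_mem _ fun e _ => hom e _ (homogeneousComponent_isHomogeneous _ _)
  exact Algebra.IsIntegral.of_finite _ _

/-! ### Rank, factorizations and minors -/

theorem det_submatrix_mul_eq_zero {R p q k t : Type*} [CommRing R] [IsDomain R] [Fintype k]
    [Fintype t] [DecidableEq t] (U : Matrix p k R) (W : Matrix k q R)
    (r : t → p) (c : t → q) (h : Fintype.card k < Fintype.card t) :
    ((U * W).submatrix r c).det = 0 := by
  by_contra hdet
  have h1 := Matrix.rank_of_det_ne_zero hdet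
  have h2 : (U * W).submatrix r c = U.submatrix r id * W.submatrix id c := by
    rw [Matrix.submatrix_mul _ _ _ _ _ Function.bijective_id]
  have h3 := Matrix.rank_mul_le_left (U.submatrix r id) (W.submatrix id c)
  have h4 := (U.submatrix r (id : k → k)).rank_le_card_width
  rw [← h2] at h3
  omega

theorem exists_mul_eq_of_rank {K p q : Type*} [Field K] [Fintype p] [Fintype q]
    (X : Matrix p q K) : ∃ (U : Matrix p (Fin X.rank) K) (W : Matrix (Fin X.rank) q K),
      X = U * W := by
  have hr := X.rank_eq_finrank_span_cols
  let S := Submodule.span K (Set.range X.col)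
  let b := Module.finBasisOfFinrankEq K S hr.symm
  refine ⟨Matrix.of fun i k => (b k : p → K) i, Matrix.of fun k j =>
    b.repr ⟨X.col j, Submodule.subset_span ⟨j, rfl⟩⟩ k, ?_⟩
  ext i j
  have := congrArg (fun v : S => (v : p → K) i)
    (b.sum_repr ⟨X.col j, Submodule.subset_span ⟨j, rfl⟩⟩)
  simp only [Submodule.coe_sum, Submodule.coe_smul, Finset.sum_apply, Pi.smul_apply,
    smul_eq_mul, Matrix.col_apply] at this
  rw [← this, Matrix.mul_apply]
  exact Finset.sum_congr rfl fun k _ => mul_comm _ _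

theorem exists_submatrix_rank_eq {K p q : Type*} [Field K] [Fintype p] [Fintype q] {t : ℕ}
    (X : Matrix p q K) (h : t ≤ X.rank) : ∃ c : Fin t → q, (X.submatrix id c).rank = t := by
  obtain ⟨κ, a, ha, hs, hli⟩ := exists_linearIndependent' K X.col
  have : Finite κ := Finite.of_injective a ha
  cases nonempty_fintype κ
  have hcard : t ≤ Fintype.card κ := by
    rw [← finrank_span_eq_card hli, hs, ← X.rank_eq_finrank_span_cols]
    exact h
  obtain ⟨e⟩ : Nonempty (Fin t ↪ κ) := Function.Embedding.nonempty_of_card_le (by simpa)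
  refine ⟨a ∘ e, ?_⟩
  have h2 : LinearIndependent K (X.submatrix id (a ∘ e)).col := hli.comp e e.injective
  rw [Matrix.rank_eq_finrank_span_cols, finrank_span_eq_card h2, Fintype.card_fin]

theorem rank_lt_of_minors_eq_zero {K p q : Type*} [Field K] [Fintype p] [Fintype q] {t : ℕ}
    (X : Matrix p q K) (h : ∀ (r : Fin t → p) (c : Fin t → q), (X.submatrix r c).det = 0) :
    X.rank < t := by
  by_contra! hX
  obtain ⟨c, hc⟩ := exists_submatrix_rank_eq X hX
  rw [← Matrix.rank_transpose] at hc
  obtain ⟨r, hr⟩ := exists_submatrix_rank_eq _ hc.ge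
  have hli : LinearIndependent K (((X.submatrix id c).transpose.submatrix id r)).col := by
    rw [linearIndependent_iff_card_eq_finrank_span, Set.finrank,
      ← Matrix.rank_eq_finrank_span_cols, hr, Fintype.card_fin]
  have hu := (Matrix.linearIndependent_cols_iff_isUnit).1 hli
  have h2 := (Matrix.isUnit_iff_isUnit_det _).1 hu
  have h3 : (X.submatrix id c).transpose.submatrix id r = (X.submatrix r c).transpose := rfl
  rw [h3, Matrix.det_transpose, h r c] at h2
  exact not_isUnit_zero h2

/-! ### Linear sections of determinantal varieties -/

open MvPolynomial in
/-- Cutting the variety of matrices of rank at most `s` of size `s + q` down to the origin takes at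
least as many linear forms as its dimension. -/
theorem dim_le_of_minors_eq_zero {K : Type*} [Field K] [IsAlgClosed K] {s q c : ℕ}
    (l : Matrix (Fin s ⊕ Fin q) (Fin s ⊕ Fin q) K →ₗ[K] (Fin c → K))
    (hl : ∀ X, l X = 0 →
      (∀ r d : Fin (s + 1) → Fin s ⊕ Fin q, (X.submatrix r d).det = 0) → X = 0) :
    (s + q) * s + s * q ≤ c := by
  classical
  let I := Fin s ⊕ Fin q
  let F : Fin c ⊕ (Fin (s + 1) → I) × (Fin (s + 1) → I) → MvPolynomial (I × I) K :=
    Sum.elim (fun i => ∑ a : I × I, C (l (Matrix.single a.1 a.2 1) i) * X a)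
      (fun rd => ((Matrix.of fun i j => (X (i, j) : MvPolynomial (I × I) K)).submatrix
        rd.1 rd.2).det)
  let deg : Fin c ⊕ (Fin (s + 1) → I) × (Fin (s + 1) → I) → ℕ :=
    Sum.elim (fun _ => 1) (fun _ => s + 1)
  have hint : Algebra.IsIntegral (Algebra.adjoin K (Set.range F)) (MvPolynomial (I × I) K) := by
    refine isIntegral_adjoin_of_homogeneous F deg ?_ ?_ ?_
    · rintro (i | rd) <;> simp [deg]
    · rintro (i | rd)
      · exact IsHomogeneous.sum _ _ _ fun a _ => isHomogeneous_C_mul_X _ _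
      · simp only [F, deg, Sum.elim_inr, Matrix.det_apply]
        refine IsHomogeneous.sum _ _ _ fun σ _ => ?_
        rw [Units.smul_def, zsmul_eq_mul, ← map_intCast (C : K →+* MvPolynomial (I × I) K)]
        refine IsHomogeneous.C_mul ?_ _
        have := IsHomogeneous.prod (Finset.univ : Finset (Fin (s + 1)))
          (fun i => (X (rd.1 (σ i), rd.2 i) : MvPolynomial (I × I) K)) (fun _ => 1)
          fun i _ => isHomogeneous_X _ _
        simpa using this
    · intro x hx
      let M : Matrix I I K := Matrix.of fun i j => x (i, j)
      have hM : M = 0 := by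
        refine hl M ?_ fun r d => ?_
        · ext i
          have h1 := hx (Sum.inl i)
          have h2 : M = ∑ a : I × I, x a • Matrix.single a.1 a.2 1 := by
            rw [Fintype.sum_prod_type]
            conv_lhs => rw [Matrix.matrix_eq_sum_single M]
            simp [M, Matrix.smul_single]
          rw [h2, map_sum, Finset.sum_apply]
          simp only [map_smul, Pi.smul_apply, smul_eq_mul]
          simpa [F, mul_comm] using h1
        · have h1 := hx (Sum.inr (r, d))
          simp only [F, Sum.elim_inr] at h1
          rw [RingHom.map_det] at h1
          rw [← h1]
          congr 1
          ext i j
          simp [M]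
      ext ⟨i, j⟩
      exact congrFun (congrFun hM i) j
  -- Generic matrix of rank `s`: columns `Y`, followed by their combinations `Y * Z`. The number of
  -- parameters is the dimension of the variety.
  let V := I × Fin s ⊕ Fin s × Fin q
  let Y : Matrix I (Fin s) (MvPolynomial V K) := Matrix.of fun i k => X (Sum.inl (i, k))
  let Z : Matrix (Fin s) (Fin q) (MvPolynomial V K) := Matrix.of fun k j => X (Sum.inr (k, j))
  let G : Matrix I I (MvPolynomial V K) := Y * Matrix.fromCols 1 Z
  let φ : MvPolynomial (I × I) K →ₐ[K] MvPolynomial V K := aeval fun a => G a.1 a.2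
  -- The map `φ` kills all minors of size `s + 1`, so the image of the large subalgebra is generated
  -- by the `c` linear forms alone.
  let S := Algebra.adjoin K (Set.range fun i => φ (F (Sum.inl i)))
  have hF : ∀ x ∈ Algebra.adjoin K (Set.range F), φ x ∈ S := by
    intro x hx
    have h1 : φ x ∈ (Algebra.adjoin K (Set.range F)).map φ := ⟨x, hx, rfl⟩
    rw [AlgHom.map_adjoin] at h1
    refine (Algebra.adjoin_le ?_ : _ ≤ S) h1
    rintro _ ⟨_, ⟨i | rd, rfl⟩, rfl⟩
    · exact Algebra.subset_adjoin ⟨i, rfl⟩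
    · have : φ (F (Sum.inr rd)) = 0 := by
        rw [← det_submatrix_mul_eq_zero Y (Matrix.fromCols 1 Z) rd.1 rd.2 (by simp)]
        simp only [F, Sum.elim_inr]
        rw [AlgHom.map_det]
        congr 1
        ext i j
        simp [φ, G]
      rw [this]
      exact S.zero_mem
  have hφ : ∀ p, IsAlgebraic S (φ p) := by
    intro p
    let ψ : Algebra.adjoin K (Set.range F) →+* S :=
      (φ.toRingHom.comp (Algebra.adjoin K (Set.range F)).val.toRingHom).codRestrict S
        fun x => hF _ x.2
    have hp := hint.isIntegral p
    exact (hp.map_of_comp_eq ψ φ.toRingHom (by ext x; rfl)).isAlgebraic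
  let Ac := Subalgebra.algebraicClosure S (MvPolynomial V K)
  have hG : ∀ i j, G i j ∈ Ac := fun i j => by
    have := hφ (X (i, j))
    change IsAlgebraic S (G i j)
    simpa [φ] using this
  have hGY : ∀ i k, G i (Sum.inl k) = Y i k := fun i k => by
    simp [G]
  have hY : ∀ i k, Y i k ∈ Ac := fun i k => hGY i k ▸ hG i _
  let T : Matrix (Fin s) (Fin s) (MvPolynomial V K) := Y.submatrix Sum.inl id
  have hGT : G.submatrix Sum.inl Sum.inr = T * Z := by
    ext i j
    simp [G, T, Matrix.mul_apply]
  have hdet : T.det ∈ Ac := by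
    rw [Matrix.det_apply]
    exact Ac.sum_mem fun σ _ => by
      rw [Units.smul_def]
      exact zsmul_mem (Ac.prod_mem fun i _ => hY _ _) _
  have hdet0 : T.det ≠ 0 := by
    intro h0
    let x : V → K := Sum.elim (fun a => if a.1 = Sum.inl a.2 then 1 else 0) (fun _ => 0)
    have h1 := congrArg (eval x) h0
    rw [RingHom.map_det, map_zero] at h1
    have h2 : (eval x).mapMatrix T = 1 := by
      ext i j
      have hij : (Sum.inl i : I) = Sum.inl j ↔ i = j := Sum.inl_injective.eq_iff
      simp [T, Y, x, Matrix.one_apply, hij]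
    rw [h2, Matrix.det_one] at h1
    exact one_ne_zero h1
  have hadj : ∀ i j, T.adjugate i j ∈ Ac := by
    intro i j
    rw [Matrix.adjugate_apply, Matrix.det_apply]
    refine Ac.sum_mem fun σ _ => ?_
    rw [Units.smul_def]
    refine zsmul_mem (Ac.prod_mem fun a _ => ?_) _
    rw [Matrix.updateRow_apply]
    split_ifs
    · rw [Pi.single_apply]
      split_ifs
      exacts [Ac.one_mem, Ac.zero_mem]
    · exact hY _ _
  have hZ : ∀ k j, Z k j ∈ Ac := by
    intro k j
    -- Cramer's rule recovers `Z` from `T * Z`, up to the nonzero algebraic factor `T.det`.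
    have h1 : T.adjugate * G.submatrix Sum.inl Sum.inr = T.det • Z := by
      rw [hGT, ← Matrix.mul_assoc, Matrix.adjugate_mul, Matrix.smul_mul, Matrix.one_mul]
    have h2 : T.det * Z k j ∈ Ac := by
      have := congrFun (congrFun h1 k) j
      rw [Matrix.smul_apply, smul_eq_mul] at this
      rw [← this, Matrix.mul_apply]
      exact Ac.sum_mem fun a _ => Ac.mul_mem (hadj _ _) (hG _ _)
    exact IsAlgebraic.of_mul (mem_nonZeroDivisors_of_ne_zero hdet0) hdet h2
  have halg : Algebra.IsAlgebraic S (MvPolynomial V K) := by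
    refine ⟨fun p => ?_⟩
    change p ∈ Ac
    induction p using MvPolynomial.induction_on with
    | C a => exact Ac.algebraMap_mem (algebraMap K S a)
    | add p q hp hq => exact Ac.add_mem hp hq
    | mul_X p v hp =>
      refine Ac.mul_mem hp ?_
      rcases v with ⟨i, k⟩ | ⟨k, j⟩
      exacts [hY i k, hZ k j]
  -- All variables are algebraic over `c` elements, so the transcendence degree, which is the number
  -- of variables, is at most `c`.
  have h1 := Algebra.IsAlgebraic.trdeg_le_cardinalMk K
    (Set.range fun i => φ (F (Sum.inl i))) (alg := halg)
  rw [MvPolynomial.trdeg_of_isDomain] at h1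
  have h2 := Cardinal.mk_range_le_lift (f := fun i => φ (F (Sum.inl i)))
  have h3 := Cardinal.lift_le.2 h1 |>.trans h2
  simp [V, I] at h3
  exact_mod_cast h3

/-- A linear space of `n × n` matrices of dimension more than `(n - s)²` contains a nonzero matrix of
rank at most `s`. -/
theorem exists_rank_le_of_sq_lt {K : Type*} [Field K] [IsAlgClosed K] {n s d : ℕ} (hs : s ≤ n)
    (hd : (n - s) ^ 2 < d) (A : (Fin d → K) →ₗ[K] Matrix (Fin n) (Fin n) K) :
    ∃ x ≠ 0, (A x).rank ≤ s := by
  obtain ⟨q, rfl⟩ := Nat.exists_eq_add_of_le hs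
  rw [Nat.add_sub_cancel_left] at hd
  by_contra! hA
  let e : Fin (s + q) ≃ Fin s ⊕ Fin q := finSumFinEquiv.symm
  let A' := (Matrix.reindexLinearEquiv K K e e).toLinearMap ∘ₗ A
  have hrank : ∀ x, (A' x).rank = (A x).rank := fun x => Matrix.rank_reindex e e (A x)
  have hinj : Function.Injective A' := by
    rw [← LinearMap.ker_eq_bot, LinearMap.ker_eq_bot']
    intro x hx
    by_contra hx0
    have := hA x hx0
    rw [← hrank, hx, Matrix.rank_zero] at this
    omega
  -- The forms `l` are equations of the range of `A'`; there are `(s + q) ^ 2 - d` of them, fewer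
  -- than `(s + q) ^ 2 - q ^ 2`.
  let Q := Matrix (Fin s ⊕ Fin q) (Fin s ⊕ Fin q) K ⧸ LinearMap.range A'
  let l := (Module.finBasis K Q).equivFun.toLinearMap ∘ₗ (LinearMap.range A').mkQ
  have h1 := dim_le_of_minors_eq_zero l fun X hX hminor => by
    have hX' : X ∈ LinearMap.range A' := by
      rw [← Submodule.Quotient.mk_eq_zero]
      exact (Module.finBasis K Q).equivFun.map_eq_zero_iff.1 hX
    obtain ⟨x, rfl⟩ := hX'
    have h := rank_lt_of_minors_eq_zero _ hminor
    by_cases hx : x = 0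
    · rw [hx, map_zero]
    · have := hA x hx
      rw [hrank] at h
      omega
  have h2 := Submodule.finrank_quotient_add_finrank (LinearMap.range A')
  rw [LinearMap.finrank_range_of_inj hinj] at h2
  simp only [Module.finrank_matrix, Module.finrank_fin_fun, Fintype.card_sum, Fintype.card_fin,
    Module.finrank_self, mul_one] at h2
  change Module.finrank K Q + d = _ at h2
  nlinarith

/-! ### Low-rank contractions of degenerations of matrix multiplication -/

/-- The contraction of a tensor with a vector along the first factor. -/
def contract {ι κ μ : Type*} [Fintype ι] (x : ι → ℂ) (S : Tensor ι κ μ) : Matrix κ μ ℂ :=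
  Matrix.of fun j k => ∑ i, x i * S i j k

theorem contract_act {ι κ μ ι' κ' μ' : Type*} [Fintype ι] [Fintype κ] [Fintype μ] [Fintype ι']
    (A : Matrix ι' ι ℂ) (B : Matrix κ' κ ℂ) (C : Matrix μ' μ ℂ) (T : Tensor ι κ μ) (x : ι' → ℂ) :
    contract x (act A B C T) = B * contract (A.transpose.mulVec x) T * C.transpose := by
  ext j' k'
  simp only [contract, act, Matrix.of_apply, Matrix.mul_apply, Matrix.transpose_apply,
    Matrix.mulVec, dotProduct, Finset.sum_mul, Finset.mul_sum]
  have hcomm : ∀ f : ι' → ι → κ → μ → ℂ,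
      ∑ i', ∑ i, ∑ j, ∑ k, f i' i j k = ∑ k, ∑ j, ∑ i, ∑ i', f i' i j k := fun f => by
    simp only [Finset.sum_comm (s := (Finset.univ : Finset ι')) (t := (Finset.univ : Finset ι)),
      Finset.sum_comm (s := (Finset.univ : Finset ι')) (t := (Finset.univ : Finset κ)),
      Finset.sum_comm (s := (Finset.univ : Finset ι')) (t := (Finset.univ : Finset μ)),
      Finset.sum_comm (s := (Finset.univ : Finset ι)) (t := (Finset.univ : Finset κ)),
      Finset.sum_comm (s := (Finset.univ : Finset ι)) (t := (Finset.univ : Finset μ)),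
      Finset.sum_comm (s := (Finset.univ : Finset κ)) (t := (Finset.univ : Finset μ))]
  rw [hcomm]
  refine Finset.sum_congr rfl fun k _ => Finset.sum_congr rfl fun j _ =>
    Finset.sum_congr rfl fun i _ => Finset.sum_congr rfl fun i' _ => ?_
  ring

theorem matMulTensor_apply (n : ℕ) (a b c : Fin n × Fin n) :
    matMulTensor n a b c = if a.1 = c.2 ∧ a.2 = b.1 ∧ b.2 = c.1 then 1 else 0 := by
  obtain ⟨i, j⟩ := a
  obtain ⟨j', k⟩ := b
  obtain ⟨k', i'⟩ := c
  simp only [matMulTensor, pureTensor, Finset.sum_apply, Pi.single_apply, Prod.mk.injEq]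
  rw [Fintype.sum_eq_single i fun x hx => by simp [hx.symm],
    Fintype.sum_eq_single j fun y hy => by simp [hy.symm],
    Fintype.sum_eq_single k fun z hz => by simp [hz.symm]]
  by_cases h1 : i = i' <;> by_cases h2 : j = j' <;> by_cases h3 : k = k' <;>
    simp [h1, h2, h3, eq_comm]

/-- The contraction is the Kronecker product of the transpose of `U * W` with the identity, so the
factorization carries over with inner dimension `k * n`. -/
theorem contract_matMulTensor {n k : ℕ} (x : Fin n × Fin n → ℂ) (U : Matrix (Fin n) (Fin k) ℂ)
    (W : Matrix (Fin k) (Fin n) ℂ) (h : ∀ i j, x (i, j) = (U * W) i j) :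
    ∃ (P : Matrix (Fin n × Fin n) (Fin k × Fin n) ℂ) (R : Matrix (Fin k × Fin n) (Fin n × Fin n) ℂ),
      contract x (matMulTensor n) = P * R := by
  refine ⟨Matrix.of fun b p => if b.2 = p.2 then W p.1 b.1 else 0,
    Matrix.of fun p c => if p.2 = c.1 then U c.2 p.1 else 0, ?_⟩
  ext ⟨j, k⟩ ⟨k', i⟩
  simp only [contract, Matrix.of_apply, matMulTensor_apply, Matrix.mul_apply, Fintype.sum_prod_type,
    h, ite_and]
  by_cases hk : k = k'
  · subst hk
    simp [mul_comm]
  · simp [hk]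

/-- The space is pulled back through the first matrix of the restriction, and the other two cannot
raise the rank. Unit norm and minors prepare for the passage to the limit. -/
theorem exists_minors_eq_zero_of_restrictsTo {ι κ μ : Type*} [Fintype ι] {n s d : ℕ} (hs : s ≤ n)
    (hd : (n - s) ^ 2 < d) (V : (Fin d → ℂ) →ₗ[ℂ] (ι → ℂ)) {S : Tensor ι κ μ}
    (hS : RestrictsTo (matMulTensor n) S) :
    ∃ x : Fin d → ℂ, ‖x‖ = 1 ∧ ∀ t : ℕ, s * n < t → ∀ (r : Fin t → κ) (c : Fin t → μ),
      ((contract (V x) S).submatrix r c).det = 0 := by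
  obtain ⟨A, B, C, rfl⟩ := hS
  let L : (Fin d → ℂ) →ₗ[ℂ] Matrix (Fin n) (Fin n) ℂ :=
    (LinearEquiv.curry ℂ ℂ (Fin n) (Fin n)).toLinearMap ∘ₗ A.transpose.mulVecLin ∘ₗ V
  obtain ⟨x, hx0, hx⟩ := exists_rank_le_of_sq_lt hs hd L
  have hnorm : (‖x‖ : ℂ)⁻¹ ≠ 0 := by simpa using hx0
  refine ⟨(‖x‖ : ℂ)⁻¹ • x, by simp [norm_smul, hx0], fun t ht r c => ?_⟩
  obtain ⟨U, W, hUW⟩ := exists_mul_eq_of_rank (L x)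
  obtain ⟨P, R, hPR⟩ := contract_matMulTensor (A.transpose.mulVec (V ((‖x‖ : ℂ)⁻¹ • x)))
    ((‖x‖ : ℂ)⁻¹ • U) W fun i j => by
      rw [map_smul, Matrix.mulVec_smul, Matrix.smul_mul, ← hUW]
      rfl
  rw [contract_act, hPR, ← Matrix.mul_assoc, Matrix.mul_assoc (B * P)]
  refine det_submatrix_mul_eq_zero _ _ _ _ ?_
  simp only [Fintype.card_prod, Fintype.card_fin]
  exact (Nat.mul_le_mul_right n hx).trans_lt ht

theorem exists_minors_eq_zero_of_degeneratesTo {ι κ μ : Type*} [Fintype ι] {n s d : ℕ}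
    (hs : s ≤ n) (hd : (n - s) ^ 2 < d) (V : (Fin d → ℂ) →ₗ[ℂ] (ι → ℂ)) {S : Tensor ι κ μ}
    (hS : DegeneratesTo (matMulTensor n) S) :
    ∃ x : Fin d → ℂ, x ≠ 0 ∧ ∀ t : ℕ, s * n < t → ∀ (r : Fin t → κ) (c : Fin t → μ),
      ((contract (V x) S).submatrix r c).det = 0 := by
  obtain ⟨T, hT, hlim⟩ := hS
  choose x hx1 hx using fun m => exists_minors_eq_zero_of_restrictsTo hs hd V (hT m)
  obtain ⟨y, hy, φ, hφ, hxy⟩ := (isCompact_sphere (0 : Fin d → ℂ) 1).tendsto_subseq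
    (x := x) fun m => by simp [hx1]
  refine ⟨y, by rintro rfl; simp at hy, fun t ht r c => ?_⟩
  have hV : Continuous V := V.continuous_of_finiteDimensional
  have hcont : Continuous fun p : (Fin d → ℂ) × Tensor ι κ μ =>
      ((contract (V p.1) p.2).submatrix r c).det := by
    refine Continuous.matrix_det (continuous_matrix fun i j => ?_)
    simp only [contract, Matrix.submatrix_apply, Matrix.of_apply]
    fun_prop
  have h1 := (hcont.tendsto (y, S)).comp (hxy.prodMk_nhds (hlim.comp hφ.tendsto_atTop))
  refine tendsto_nhds_unique h1 ?_
  simp only [Function.comp_def, hx _ t ht r c]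
  exact tendsto_const_nhds

/-! ### Unit tensors -/

theorem contract_unitTensor {r : ℕ} (x : Fin r → ℂ) :
    contract x (unitTensor r) = Matrix.diagonal x := by
  ext j k
  simp only [contract, Matrix.of_apply, unitTensor_apply, Matrix.diagonal_apply]
  by_cases h : j = k <;> simp [h]

/-- Polynomials of degree below `d`, evaluated at `r` distinct points, form a `d`-dimensional family
in which a nonzero member vanishes at most `d - 1` times (a Reed–Solomon code). -/
theorem le_of_degeneratesTo_unitTensor {n s r : ℕ} (hs : s ≤ n)
    (h : DegeneratesTo (matMulTensor n) (unitTensor r)) : r ≤ (n - s) ^ 2 + s * n := by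
  classical
  let d := (n - s) ^ 2 + 1
  let ev : Polynomial ℂ →ₗ[ℂ] (Fin r → ℂ) :=
    LinearMap.pi fun i => Polynomial.leval ((i : ℕ) : ℂ)
  let V : (Fin d → ℂ) →ₗ[ℂ] (Fin r → ℂ) :=
    ev ∘ₗ (Polynomial.degreeLT ℂ d).subtype ∘ₗ (Polynomial.degreeLTEquiv ℂ d).symm.toLinearMap
  obtain ⟨x, hx0, hx⟩ := exists_minors_eq_zero_of_degeneratesTo hs (Nat.lt_succ_self _ : _ < d) V h
  let p := (Polynomial.degreeLTEquiv ℂ d).symm x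
  have hp0 : (p : Polynomial ℂ) ≠ 0 := by simpa [p] using hx0
  have hdeg : (p : Polynomial ℂ).natDegree < d :=
    (Polynomial.natDegree_lt_iff_degree_lt hp0).2 (Polynomial.mem_degreeLT.1 p.2)
  have hV : ∀ i, V x i = (p : Polynomial ℂ).eval ((i : ℕ) : ℂ) := fun i => rfl
  let Zs : Finset (Fin r) := {i | V x i = 0}
  have hZ : Zs.card < d := by
    refine lt_of_le_of_lt ?_ hdeg
    refine le_trans ?_ ((Polynomial.card_roots' (p : Polynomial ℂ)))
    refine le_trans ?_ (Multiset.toFinset_card_le _)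
    refine Finset.card_le_card_of_injOn (fun i => ((i : ℕ) : ℂ)) (fun i hi => ?_) ?_
    · simp only [Zs, Finset.coe_filter, Finset.mem_univ, true_and, Set.mem_ofPred_eq, hV] at hi
      simp [hp0, hi]
    · intro i _ j _ hij
      exact Fin.ext (Nat.cast_injective hij)
  by_contra! hr
  have hcard : Zs.card + Zsᶜ.card = r := by simp
  -- At most `(n - s) ^ 2` entries vanish, leaving more than `s * n` nonzero diagonal entries, whose
  -- product is a minor that should vanish.
  obtain ⟨e⟩ : Nonempty (Fin (s * n + 1) ↪ {i // i ∈ Zsᶜ}) :=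
    Function.Embedding.nonempty_of_card_le (by
      rw [Fintype.card_fin, Fintype.card_coe]
      simp only [d] at hZ
      omega)
  let f : Fin (s * n + 1) → Fin r := fun i => e i
  have hf : Function.Injective f := Subtype.val_injective.comp e.injective
  have h0 := hx (s * n + 1) (Nat.lt_succ_self _) f f
  rw [contract_unitTensor, Matrix.submatrix_diagonal _ _ hf, Matrix.det_diagonal,
    Finset.prod_eq_zero_iff] at h0
  obtain ⟨i, -, hi⟩ := h0
  have := (e i).2
  simp only [Zs, Finset.mem_compl, Finset.mem_filter, Finset.mem_univ, true_and] at this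
  exact this hi

/-! ### Polynomial multiplication tensors -/

theorem polyMulTensor_apply (a b : ℕ) (i : Fin a) (j : Fin b) (k : Fin (a + b - 1)) :
    polyMulTensor a b i j k = if (k : ℕ) = i + j then 1 else 0 := by
  simp only [polyMulTensor, pureTensor, Finset.sum_apply, Pi.single_apply]
  rw [Fintype.sum_eq_single i fun x hx => by simp [hx.symm],
    Fintype.sum_eq_single j fun y hy => by simp [hy.symm]]
  simp [Fin.ext_iff]

theorem not_degeneratesTo_polyMulTensor {n s a b : ℕ} (hs : s ≤ n) (ha : (n - s) ^ 2 < a)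
    (hb : s * n < b) : ¬ DegeneratesTo (matMulTensor n) (polyMulTensor a b) := by
  classical
  intro h
  obtain ⟨x, hx0, hx⟩ := exists_minors_eq_zero_of_degeneratesTo hs ha LinearMap.id h
  simp only [LinearMap.id_apply] at hx
  have hne : (Finset.univ.filter fun i => x i ≠ 0).Nonempty := by
    obtain ⟨i, hi⟩ := Function.ne_iff.1 hx0
    exact ⟨i, by simpa using hi⟩
  obtain ⟨i₀, hi₀, hmin⟩ := Finset.exists_minimal hne
  -- With `i₀` the least index in the support of `x`, the columns shifted by `i₀` form a triangular
  -- `b × b` block with diagonal `x i₀`.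
  have h0 := hx b hb id fun j => ⟨i₀ + j, by have := i₀.2; have := j.2; omega⟩
  rw [Matrix.det_of_isUpperTriangular, Finset.prod_eq_zero_iff] at h0
  · obtain ⟨j, -, hj⟩ := h0
    simp only [contract, Matrix.submatrix_apply, Matrix.of_apply, polyMulTensor_apply, id,
      add_left_inj] at hj
    rw [Fintype.sum_eq_single i₀ fun i hi => by
      rw [if_neg fun h => hi (Fin.ext h.symm), mul_zero], if_pos rfl, mul_one] at hj
    simp [hj] at hi₀
  · intro j j' hjj
    simp only [contract, Matrix.submatrix_apply, Matrix.of_apply, polyMulTensor_apply, id]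
    refine Finset.sum_eq_zero fun i _ => ?_
    by_cases hi : x i = 0
    · rw [hi, zero_mul]
    · have h1 : i₀ ≤ i := le_of_not_gt fun hlt =>
        not_le_of_gt hlt (hmin (by simpa using hi) hlt.le)
      have h2 : (j' : ℕ) < j := hjj
      have h3 : (i₀ : ℕ) ≤ i := h1
      rw [if_neg (by omega), mul_zero]

end BorderSubrank

theorem theorem1p6 (n : ℕ) :
    BorderSubrank.borderSubrank (BorderSubrank.matMulTensor n) ≤ ⌈(3 / 4 : ℝ) * (n : ℝ) ^ 2⌉₊ ∧
    ∀ a b : ℕ, 1 ≤ a → 1 ≤ b →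
      (b : ℤ) > (n : ℤ) * ((n : ℤ) - ⌊Real.sqrt ((a : ℝ) - 1)⌋) →
      ¬ BorderSubrank.DegeneratesTo (BorderSubrank.matMulTensor n)
        (BorderSubrank.polyMulTensor a b) := by
  constructor
  -- Half of `n` minimizes `(n - s) ^ 2 + s * n`.
  · have h1 := BorderSubrank.le_of_degeneratesTo_unitTensor (s := n / 2) (Nat.div_le_self n 2)
      (BorderSubrank.isGreatest_borderSubrank (BorderSubrank.matMulTensor n)).1
    refine h1.trans ?_
    obtain ⟨k, rfl | rfl⟩ := Nat.even_or_odd' n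
    · rw [show 2 * k / 2 = k by omega, show 2 * k - k = k by omega]
      have : ((k ^ 2 + k * (2 * k) : ℕ) : ℝ) ≤ 3 / 4 * ((2 * k : ℕ) : ℝ) ^ 2 := by
        push_cast
        linarith
      exact_mod_cast this.trans (Nat.le_ceil _)
    · rw [show (2 * k + 1) / 2 = k by omega, show 2 * k + 1 - k = k + 1 by omega]
      have h2 : ((k + 1) ^ 2 + k * (2 * k + 1) : ℕ) = 3 * k ^ 2 + 3 * k + 1 := by ring
      rw [h2]
      -- For odd `n` the bound exceeds three quarters of `n ^ 2` by exactly one quarter, so the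
      -- ceiling absorbs it.
      refine Nat.lt_ceil.2 ?_
      push_cast
      nlinarith
  · intro a b ha hb hab
    obtain ⟨q, hq⟩ : ∃ q : ℕ, ⌊Real.sqrt ((a : ℝ) - 1)⌋ = q :=
      Int.eq_ofNat_of_zero_le (Int.floor_nonneg.2 (Real.sqrt_nonneg _))
    have hqa : q ^ 2 < a := by
      have h1 : (q : ℝ) ≤ Real.sqrt ((a : ℝ) - 1) := by
        have := Int.floor_le (Real.sqrt ((a : ℝ) - 1))
        rw [hq] at this
        exact_mod_cast this
      have ha' : (1 : ℝ) ≤ a := by exact_mod_cast ha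
      have h2 := (Real.le_sqrt (Nat.cast_nonneg q) (by linarith)).1 h1
      have h3 : (q : ℝ) ^ 2 < a := by linarith
      exact_mod_cast h3
    rw [hq] at hab
    rcases le_total q n with hqn | hqn
    · refine BorderSubrank.not_degeneratesTo_polyMulTensor (s := n - q) (Nat.sub_le n q) ?_ ?_
      · rwa [Nat.sub_sub_self hqn]
      · zify [hqn]
        linarith
    -- Here `n - q` would not be positive; `s = 0` suffices, needing only `b ≥ 1`.
    · refine BorderSubrank.not_degeneratesTo_polyMulTensor (s := 0) (Nat.zero_le n) ?_ ?_
      · rw [Nat.sub_zero]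
        exact (Nat.pow_le_pow_left hqn 2).trans_lt hqa
      · omega
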